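/- Let $\mathbb{k}$ be a field and $R=\mathbb{k}[x_1,\dots,x_n]$ with the standard grading. For a homogeneous ideal $I\subseteq R$ let $\beta_{i,j}(I)=\dim_{\mathbb{k}}\mathrm{Tor}_i^R(I,\mathbb{k})_j$ be its graded Betti numbers (with $\beta_{-1,j}(I)=0$), and for a monomial ideal $I$ let $G(I)$ be its minimal system of monomial generators. An ideal $I$ has a $d$-linear resolution if it is generated in degree $d$ and $\beta_{i,i+j}(I)=0$ for all $i,j\in\mathbb{N}$ with $j\neq d$. If $I,J,K$ are monomial ideals such that $I=J+K$ and $G(I)$ is the disjoint union of $G(J)$ and $G(K)$, then $I=J+K$ is called a Betti splitting of $I$ if $$\beta_{i,j}(I)=\beta_{i,j}(J)+\beta_{i,j}(K)+\beta_{i-1,j}(J\cap K)\quad\text{for all } i,j\in\mathbb{N}.$$ Let $d$ be a positive integer, $I$ a monomial ideal with a $d$-linear resolution, and $J,K\neq 0$ monomial ideals such that $I=J+K$, $G(I)=G(J)\cup G(K)$ and $G(J)\cap G(K)=\emptyset$. Then the following are equivalent: (i) $I=J+K$ is a Betti splitting of $I$; (ii) $J$ and $K$ have $d$-linear resolutions.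 If this is the case, then $J\cap K$ has a $(d+1)$-linear resolution. -/

import Mathlib

open MvPolynomial

namespace BettiSplitting

universe u

variable {k : Type u} [Field k] {n : ℕ}

/-! ### Monomial ideals and their minimal monomial generators -/

/-- `I` is a monomial ideal: it is generated by a set of monomials `x ^ a`. -/
def IsMonomialIdeal (I : Ideal (MvPolynomial (Fin n) k)) : Prop :=
  ∃ s : Set (Fin n →₀ ℕ), I = Ideal.span ((fun a => monomial a (1 : k)) '' s)

/-- The minimal system of monomial generators `G(I)`, a monomial `x ^ a` being recorded through its
exponent vector `a`: the monomials in `I` that are minimal for divisibility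
(`x ^ a ∣ x ^ b` if and only if `a ≤ b` coordinatewise). -/
def minGens (I : Ideal (MvPolynomial (Fin n) k)) : Set (Fin n →₀ ℕ) :=
  {a | Minimal (fun b : Fin n →₀ ℕ => monomial b (1 : k) ∈ I) a}

/-! ### The Koszul complex, a graded free resolution of the residue field

The exterior algebra of `R ^ n`, `R = k[x_1, …, x_n]`, is the free module with basis `e_S`,
`S ⊆ {1, …, n}`; the element `∑ f S • e_S` is written as the function `f`. The basis vector `e_S`
has homological degree `#S` and internal degree `#S`. -/

/-- The sign of `v` relative to `T`: `(-1) ^ #{u ∈ T | u < v}`. -/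
def koszulSign (v : Fin n) (T : Finset (Fin n)) : ℤ := (-1) ^ (T.filter (· < v)).card

variable (k n) in
/-- The Koszul differential: for `v_0 < … < v_r`, it sends `e_{v_0, …, v_r}` to
`∑ (-1) ^ i x_{v_i} e_{v_0, …, v_r without v_i}`. Here it is written through coefficients. -/
noncomputable def koszulD :
    (Finset (Fin n) → MvPolynomial (Fin n) k) →ₗ[MvPolynomial (Fin n) k]
      (Finset (Fin n) → MvPolynomial (Fin n) k) where
  toFun f T := ∑ v ∈ Tᶜ, koszulSign v T • (X v * f (insert v T))
  map_add' f g := by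
    funext T
    simp only [Pi.add_apply, mul_add, smul_add, Finset.sum_add_distrib]
  map_smul' r f := by
    funext T
    simp only [Pi.smul_apply, smul_eq_mul, RingHom.id_apply, Finset.mul_sum]
    refine Finset.sum_congr rfl fun v _ => ?_
    rw [mul_smul_comm, mul_left_comm]

variable (k n) in
/-- The `i`-th module of the Koszul complex, free with basis `e_S`, `#S = i`. -/
def koszulModule (i : ℕ) :
    Submodule (MvPolynomial (Fin n) k) (Finset (Fin n) → MvPolynomial (Fin n) k) where
  carrier := {f | ∀ S, S.card ≠ i → f S = 0}
  add_mem' hf hg S hS := by simp [hf S hS, hg S hS]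
  zero_mem' _ _ := rfl
  smul_mem' r f hf S hS := by simp [hf S hS]

theorem koszulD_apply (f : Finset (Fin n) → MvPolynomial (Fin n) k) (T : Finset (Fin n)) :
    koszulD k n f T = ∑ v ∈ Tᶜ, koszulSign v T • (X v * f (insert v T)) := rfl

theorem koszulD_mem {i : ℕ} {f : Finset (Fin n) → MvPolynomial (Fin n) k}
    (hf : f ∈ koszulModule k n (i + 1)) : koszulD k n f ∈ koszulModule k n i := by
  intro T hT
  rw [koszulD_apply]
  refine Finset.sum_eq_zero fun v hv => ?_
  rw [hf (insert v T), mul_zero, smul_zero]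
  rw [Finset.card_insert_of_notMem (Finset.mem_compl.1 hv)]
  omega

theorem koszulSign_swap {v w : Fin n} (hvw : v ≠ w) {T : Finset (Fin n)} (hv : v ∉ T)
    (hw : w ∉ T) :
    koszulSign w (insert v T) * koszulSign v T = - (koszulSign v (insert w T) * koszulSign w T) := by
  unfold koszulSign
  rw [Finset.filter_insert, Finset.filter_insert]
  rcases lt_or_gt_of_ne hvw with h | h
  · rw [if_pos h, if_neg (not_lt.2 h.le), Finset.card_insert_of_notMem (by simp [hv])]
    ring
  · rw [if_pos h, if_neg (not_lt.2 h.le), Finset.card_insert_of_notMem (by simp [hw])]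
    ring

theorem koszulSign_mul_self (v : Fin n) (T : Finset (Fin n)) :
    koszulSign v T * koszulSign v T = 1 := by
  unfold koszulSign
  rw [← mul_pow]
  simp

theorem koszulD_koszulD (f : Finset (Fin n) → MvPolynomial (Fin n) k) :
    koszulD k n (koszulD k n f) = 0 := by
  funext T
  simp only [koszulD_apply, Finset.mul_sum, Finset.smul_sum, Pi.zero_apply]
  rw [Finset.sum_sigma']
  refine Finset.sum_involution (fun p _ => ⟨p.2, p.1⟩) ?_ ?_ ?_ ?_
  · rintro ⟨v, w⟩ h
    simp only [Finset.mem_sigma, Finset.mem_compl, Finset.mem_insert, not_or] at h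
    obtain ⟨hv, hwv, hw⟩ := h
    have key := koszulSign_swap (Ne.symm hwv) hv hw
    simp only [mul_smul_comm, smul_smul]
    rw [Finset.insert_comm w v T, mul_left_comm (X w) (X v), mul_comm (koszulSign v T),
      mul_comm (koszulSign w T), key, neg_smul, neg_add_cancel]
  · rintro ⟨v, w⟩ h _ h'
    simp only [Finset.mem_sigma, Finset.mem_compl, Finset.mem_insert, not_or] at h
    simp only [Sigma.mk.injEq] at h'
    exact h.2.1 h'.1
  · rintro ⟨v, w⟩ h
    simp only [Finset.mem_sigma, Finset.mem_compl, Finset.mem_insert, not_or] at h ⊢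
    exact ⟨h.2.2, Ne.symm h.2.1, h.1⟩
  · rintro ⟨v, w⟩ h
    rfl

theorem divMonomial_X_mul {v w : Fin n} (h : w ≠ v) (g : MvPolynomial (Fin n) k) :
    (X w * g).divMonomial (Finsupp.single v 1) = X w * g.divMonomial (Finsupp.single v 1) := by
  ext a
  rw [coeff_divMonomial, coeff_X_mul', coeff_X_mul']
  have : w ∈ (Finsupp.single v 1 + a).support ↔ w ∈ a.support := by
    simp [h.symm]
  simp only [this]
  split_ifs with hw
  · rw [coeff_divMonomial]
    congr 1
    ext u
    simp only [Finsupp.coe_add, Finsupp.coe_tsub, Pi.add_apply, Pi.sub_apply,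
      Finsupp.single_apply]
    by_cases h1 : v = u <;> by_cases h2 : w = u <;> simp_all
  · rfl

/-- Clearing one variable: a cycle is homologous to a cycle that vanishes on all `S ∋ v`. -/
theorem exists_koszul_homotopy {i : ℕ} {f : Finset (Fin n) → MvPolynomial (Fin n) k}
    (hf : f ∈ koszulModule k n i) (hd : koszulD k n f = 0) (v : Fin n) :
    ∃ g ∈ koszulModule k n (i + 1), ∀ S,
      f S - koszulD k n g S = if v ∈ S then 0 else (f S).modMonomial (Finsupp.single v 1) := by
  classical
  refine ⟨fun S => if v ∈ S then koszulSign v (S.erase v) •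
    (f (S.erase v)).divMonomial (Finsupp.single v 1) else 0, ?_, ?_⟩
  · intro S hS
    by_cases hv : v ∈ S
    · simp only [hv, if_true]
      rw [hf (S.erase v), zero_divMonomial, smul_zero]
      have := Finset.card_erase_add_one hv
      omega
    · simp only [hv, if_false]
  · intro T
    rw [koszulD_apply]
    by_cases hv : v ∈ T
    · simp only [hv, if_true, Finset.mem_insert, or_true]
      have h0 := congrFun hd (T.erase v)
      rw [koszulD_apply, Finset.compl_erase, Finset.sum_insert (by simp [hv]),
        Finset.insert_erase hv, Pi.zero_apply] at h0
      have h1 := congrArg (fun p => koszulSign v (T.erase v) •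
        p.divMonomial (Finsupp.single v 1)) h0
      simp only [zero_divMonomial, smul_zero] at h1
      have hlin : ∀ (z : ℤ) (p : MvPolynomial (Fin n) k),
          (z • p).divMonomial (Finsupp.single v 1) = z • p.divMonomial (Finsupp.single v 1) := by
        intro z p
        ext a
        rw [coeff_divMonomial, coeff_smul, coeff_smul, coeff_divMonomial]
      have hsum : ∀ (s : Finset (Fin n)) (q : Fin n → MvPolynomial (Fin n) k),
          (∑ w ∈ s, q w).divMonomial (Finsupp.single v 1) =
            ∑ w ∈ s, (q w).divMonomial (Finsupp.single v 1) := by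
        intro s q
        ext a
        simp [coeff_divMonomial, coeff_sum]
      rw [add_divMonomial, hlin, X_mul_divMonomial, hsum, smul_add, smul_smul,
        koszulSign_mul_self, one_smul, Finset.smul_sum] at h1
      rw [sub_eq_zero, eq_neg_of_add_eq_zero_left h1, ← Finset.sum_neg_distrib]
      refine Finset.sum_congr rfl fun w hw => ?_
      have hwT : w ∉ T := Finset.mem_compl.1 hw
      have hwv : w ≠ v := fun h => hwT (h ▸ hv)
      have key := koszulSign_swap hwv.symm (T := T.erase v) (by simp) (by simp [hwT])
      rw [Finset.insert_erase hv] at key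
      rw [hlin, divMonomial_X_mul hwv, Finset.erase_insert_of_ne hwv, mul_smul_comm, smul_smul,
        smul_smul, ← neg_smul]
      congr 1
      have e1 := koszulSign_mul_self v (T.erase v)
      have e2 := koszulSign_mul_self v (insert w (T.erase v))
      linear_combination -(koszulSign v (T.erase v) * koszulSign v (insert w (T.erase v))) * key +
        koszulSign v (insert w (T.erase v)) * koszulSign w T * e1 +
        koszulSign v (T.erase v) * koszulSign w (T.erase v) * e2
    · simp only [hv, if_false]
      rw [Finset.sum_eq_single v]
      · simp only [Finset.mem_insert_self, if_true, Finset.erase_insert hv]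
        rw [mul_smul_comm, smul_smul, koszulSign_mul_self, one_smul, sub_eq_iff_eq_add,
          add_comm, X, divMonomial_add_modMonomial]
      · intro w _ hwv
        simp [hv, hwv.symm]
      · intro h
        exact absurd (Finset.mem_compl.2 hv) h

/-- The Koszul complex is exact in positive homological degrees. -/
theorem koszul_exact {i : ℕ} {f : Finset (Fin n) → MvPolynomial (Fin n) k}
    (hf : f ∈ koszulModule k n (i + 1)) (hd : koszulD k n f = 0) :
    ∃ g ∈ koszulModule k n (i + 2), koszulD k n g = f := by
  classical
  have main : ∀ A : Finset (Fin n), ∃ g ∈ koszulModule k n (i + 2),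
      ∀ S : Finset (Fin n), ¬ Disjoint S A → (f - koszulD k n g) S = 0 := by
    intro A
    induction A using Finset.induction_on with
    | empty => exact ⟨0, Submodule.zero_mem _, fun S hS => absurd (Finset.disjoint_empty_right S) hS⟩
    | insert v A _ ih =>
      obtain ⟨g, hg, hgA⟩ := ih
      obtain ⟨g', hg', h'⟩ := exists_koszul_homotopy (v := v)
        (Submodule.sub_mem _ hf (koszulD_mem hg))
        (by rw [map_sub, hd, koszulD_koszulD, sub_zero])
      refine ⟨g + g', Submodule.add_mem _ hg hg', fun S hS => ?_⟩
      rw [map_add, ← sub_sub, Pi.sub_apply, h' S]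
      split_ifs with hv
      · rfl
      · rw [Finset.disjoint_insert_right, not_and] at hS
        rw [hgA S (hS hv)]
        have h0 := divMonomial_add_modMonomial (0 : MvPolynomial (Fin n) k) (Finsupp.single v 1)
        rwa [zero_divMonomial, mul_zero, zero_add] at h0
  obtain ⟨g, hg, h⟩ := main Finset.univ
  refine ⟨g, hg, (sub_eq_zero.1 (_root_.funext fun S => ?_)).symm⟩
  by_cases hS : S = ∅
  · exact Submodule.sub_mem _ hf (koszulD_mem hg) S (by simp [hS])
  · refine h S fun hdis => hS ?_
    rw [← Finset.top_eq_univ, disjoint_top] at hdis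
    exact hdis

/-- The cokernel of the last Koszul differential is the residue field `R ⧸ (x_1, …, x_n)`. -/
theorem koszul_augmentation {f : Finset (Fin n) → MvPolynomial (Fin n) k}
    (hf : f ∈ koszulModule k n 0) :
    (∃ g ∈ koszulModule k n 1, koszulD k n g = f) ↔
      f ∅ ∈ Ideal.span (Set.range (X : Fin n → MvPolynomial (Fin n) k)) := by
  classical
  rw [Ideal.mem_span_range_iff_exists_fun]
  constructor
  · rintro ⟨g, -, rfl⟩
    exact ⟨fun v => g {v}, by simp [koszulD_apply, koszulSign, mul_comm]⟩
  · rintro ⟨c, hc⟩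
    have hg : (fun S : Finset (Fin n) => if S.card = 1 then ∑ v ∈ S, c v else 0) ∈
        koszulModule k n 1 := fun S hS => if_neg hS
    refine ⟨_, hg, _root_.funext fun S => ?_⟩
    by_cases hS : S = ∅
    · subst hS
      rw [← hc]
      simp [koszulD_apply, koszulSign, mul_comm]
    · rw [hf S (by simpa using hS), koszulD_mem hg S (by simpa using hS)]

/-! ### Graded Betti numbers

By the facts above the Koszul complex `K` is a graded free resolution of `k`, so
`Tor_i(I, k) = H_i(K ⊗ I)` as graded vector spaces. The module `K_i ⊗ I` is the module of the
functions on the `i`-element sets with values in `I`, and its part of degree `j` consists of those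
with values in the part of `I` of degree `j - i`. -/

/-- The degree `j` part of `K_i ⊗ I`. -/
def koszulChains (I : Ideal (MvPolynomial (Fin n) k)) (i j : ℕ) :
    Submodule k (Finset (Fin n) → MvPolynomial (Fin n) k) where
  carrier := {f | f ∈ koszulModule k n i ∧
    ∀ S, f S ∈ I ∧ (i ≤ j → (f S).IsHomogeneous (j - i)) ∧ (j < i → f S = 0)}
  add_mem' hf hg := ⟨Submodule.add_mem _ hf.1 hg.1, fun S =>
    ⟨I.add_mem (hf.2 S).1 (hg.2 S).1, fun h => ((hf.2 S).2.1 h).add ((hg.2 S).2.1 h),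
      fun h => by simp [(hf.2 S).2.2 h, (hg.2 S).2.2 h]⟩⟩
  zero_mem' := ⟨Submodule.zero_mem _, fun S =>
    ⟨I.zero_mem, fun _ => isHomogeneous_zero _ _ _, fun _ => rfl⟩⟩
  smul_mem' c f hf := ⟨fun S hS => by simp [hf.1 S hS], fun S =>
    ⟨Submodule.smul_of_tower_mem I c (hf.2 S).1,
      fun h => (homogeneousSubmodule (Fin n) k (j - i)).smul_mem c ((hf.2 S).2.1 h),
      fun h => by simp [(hf.2 S).2.2 h]⟩⟩

/-- The cycles in the degree `j` part of `K_i ⊗ I` (all of it if `i = 0`). -/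
noncomputable def koszulCycles (I : Ideal (MvPolynomial (Fin n) k)) (i j : ℕ) :
    Submodule k (Finset (Fin n) → MvPolynomial (Fin n) k) :=
  koszulChains I i j ⊓ LinearMap.ker ((koszulD k n).restrictScalars k)

/-- The boundaries in the degree `j` part of `K_i ⊗ I`. -/
noncomputable def koszulBoundaries (I : Ideal (MvPolynomial (Fin n) k)) (i j : ℕ) :
    Submodule k (Finset (Fin n) → MvPolynomial (Fin n) k) :=
  (koszulChains I (i + 1) j).map ((koszulD k n).restrictScalars k)

/-- The vector space `Tor_i(I, k)_j`, the cycles modulo the boundaries. -/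
abbrev gradedTor (I : Ideal (MvPolynomial (Fin n) k)) (i j : ℕ) : Type u :=
  ↥(koszulCycles I i j) ⧸ (koszulBoundaries I i j).submoduleOf (koszulCycles I i j)

/-- The graded Betti number `β_{i,j}(I) = dim_k Tor_i(I, k)_j`. -/
noncomputable def gradedBetti (I : Ideal (MvPolynomial (Fin n) k)) (i j : ℕ) : ℕ :=
  Module.finrank k (gradedTor I i j)

/-! ### Linear resolutions and Betti splittings -/

/-- `I` is generated by homogeneous elements of degree `d`. -/
def IsGeneratedInDegree (I : Ideal (MvPolynomial (Fin n) k)) (d : ℕ) : Prop :=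
  Ideal.span {f | f ∈ I ∧ f.IsHomogeneous d} = I

/-- `I` is generated in degree `d` and has a `d`-linear resolution:
`β_{i,i+j}(I) = 0` for all `i, j` with `j ≠ d`. -/
def HasLinearResolution (I : Ideal (MvPolynomial (Fin n) k)) (d : ℕ) : Prop :=
  IsGeneratedInDegree I d ∧ ∀ i j : ℕ, j ≠ d → gradedBetti I i (i + j) = 0

/-- `J + K` is a Betti splitting of `I`: `I = J + K`, `G(I)` is the disjoint union of `G(J)` and
`G(K)`, and `β_{i,j}(I) = β_{i,j}(J) + β_{i,j}(K) + β_{i-1,j}(J ∩ K)` for all `i, j`, where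
`β_{-1,j} = 0`. -/
structure IsBettiSplitting (I J K : Ideal (MvPolynomial (Fin n) k)) : Prop where
  eq_add : I = J + K
  minGens_eq : minGens I = minGens J ∪ minGens K
  minGens_disjoint : Disjoint (minGens J) (minGens K)
  betti_zero : ∀ j : ℕ, gradedBetti I 0 j = gradedBetti J 0 j + gradedBetti K 0 j
  betti_succ : ∀ i j : ℕ, gradedBetti I (i + 1) j =
    gradedBetti J (i + 1) j + gradedBetti K (i + 1) j + gradedBetti (J ⊓ K) i j

end BettiSplitting

/-!
Taking Koszul chains of a fixed internal degree `j` turns intersections and sums of monomial ideals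
into intersections and sums of subspaces (`koszulChains_inf`, `koszulChains_sup`), so the Koszul
complexes of `J ∩ K`, `J`, `K` and `I = J + K` are linked by a short exact sequence and their Betti
numbers by the long exact sequence of `Tor(-, k)_j`.

If `J` and `K` have `d`-linear resolutions, every map `Tor_i(J ∩ K)_j → Tor_i(J)_j ⊕ Tor_i(K)_j`
is zero (`koszulCycles_inf_le_koszulBoundaries`). For `j ≠ i + d` the target vanishes. For
`j = i + d` the source vanishes, because `J ∩ K` has no element of degree `d`: a monomial of degree
`d` in it would be a minimal generator of both `J` and `K`. The long exact sequence then breaks up,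
and the Betti numbers add as in a Betti splitting. This last step is carried out without the
connecting homomorphism: all cycles of `J ∩ K` being boundaries of `J` and of `K`, the common
boundaries of `J` and `K` are exactly the cycles of `J ∩ K`, and rank–nullity does the rest
(`gradedBetti_sup_zero`, `gradedBetti_sup_succ`).

Conversely, in a Betti splitting the Betti numbers of `J` and `K`, and the shifted ones of `J ∩ K`,
are bounded by those of `I`, which gives the required vanishing. The ideals `J` and `K` are
generated in degree `d` because their minimal generators are among those of `I`. For `J ∩ K`,
a minimal generator of degree `e` makes `β_{0,e}` nonzero
(`IsMonomialIdeal.gradedBetti_zero_ne_zero`), which forces `e = d + 1`.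
-/

namespace BettiSplitting

universe u

variable {k : Type u} [Field k] {n : ℕ}

/-! ### Monomial ideals and their generating degrees -/

section MonomialIdeals

variable {I J K : Ideal (MvPolynomial (Fin n) k)}

theorem IsMonomialIdeal.mem_iff (hI : IsMonomialIdeal I) {f : MvPolynomial (Fin n) k} :
    f ∈ I ↔ ∀ a ∈ f.support, monomial a (1 : k) ∈ I := by
  obtain ⟨s, rfl⟩ := hI
  simp only [mem_ideal_span_monomial_image]
  refine forall₂_congr fun a _ => ?_
  simp

theorem isMonomialIdeal_of_forall_support
    (h : ∀ f ∈ I, ∀ a ∈ f.support, monomial a (1 : k) ∈ I) : IsMonomialIdeal I := by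
  refine ⟨{a | monomial a (1 : k) ∈ I}, le_antisymm (fun f hf => ?_) ?_⟩
  · exact mem_ideal_span_monomial_image.2 fun a ha => ⟨a, h f hf a ha, le_rfl⟩
  · rw [Ideal.span_le]
    rintro _ ⟨a, ha, rfl⟩
    exact ha

theorem IsMonomialIdeal.inf (hJ : IsMonomialIdeal J) (hK : IsMonomialIdeal K) :
    IsMonomialIdeal (J ⊓ K) :=
  isMonomialIdeal_of_forall_support fun _ hf a ha =>
    ⟨hJ.mem_iff.1 hf.1 a ha, hK.mem_iff.1 hf.2 a ha⟩

theorem IsMonomialIdeal.homogeneousComponent_mem (hI : IsMonomialIdeal I)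
    {f : MvPolynomial (Fin n) k} (hf : f ∈ I) (e : ℕ) : homogeneousComponent e f ∈ I := by
  refine hI.mem_iff.2 fun a ha => hI.mem_iff.1 hf a ?_
  rw [mem_support_iff, coeff_homogeneousComponent] at ha
  exact mem_support_iff.2 fun h => ha (by simp [h])

theorem exists_minGens_le {a : Fin n →₀ ℕ} (ha : monomial a (1 : k) ∈ I) :
    ∃ b ∈ minGens I, b ≤ a := by
  obtain ⟨b, hba, hb⟩ := exists_minimal_le_of_wellFoundedLT
    (fun b : Fin n →₀ ℕ => monomial b (1 : k) ∈ I) a ha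
  exact ⟨b, hb, hba⟩

theorem IsMonomialIdeal.isGeneratedInDegree (hI : IsMonomialIdeal I) {d : ℕ}
    (h : ∀ a ∈ minGens I, a.degree = d) : IsGeneratedInDegree I d := by
  refine le_antisymm (Ideal.span_le.2 fun f hf => hf.1) fun f hf => ?_
  have hle : Ideal.span ((fun a => monomial a (1 : k)) '' minGens I) ≤
      Ideal.span {f | f ∈ I ∧ f.IsHomogeneous d} := by
    refine Ideal.span_mono ?_
    rintro _ ⟨a, ha, rfl⟩
    exact ⟨ha.1, isHomogeneous_monomial _ (h a ha)⟩
  exact hle (mem_ideal_span_monomial_image.2 fun a ha =>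
    exists_minGens_le (hI.mem_iff.1 hf a ha))

/-- The homogeneous elements of degree `d` of a monomial ideal are combinations of its monomials of
degree `d`, so if the former generate the ideal, the latter do. -/
theorem IsMonomialIdeal.exists_le_of_isGeneratedInDegree (hI : IsMonomialIdeal I) {d : ℕ}
    (h : IsGeneratedInDegree I d) {a : Fin n →₀ ℕ} (ha : monomial a (1 : k) ∈ I) :
    ∃ b ≤ a, monomial b (1 : k) ∈ I ∧ b.degree = d := by
  have hle : I ≤ Ideal.span ((fun a => monomial a (1 : k)) ''
      {b | monomial b (1 : k) ∈ I ∧ b.degree = d}) := by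
    conv_lhs => rw [← h]
    refine Ideal.span_le.2 fun f hf => mem_ideal_span_monomial_image.2 fun b hb => ?_
    refine ⟨b, ⟨hI.mem_iff.1 hf.1 b hb, ?_⟩, le_rfl⟩
    by_contra hne
    exact mem_support_iff.1 hb (hf.2.coeff_eq_zero hne)
  obtain ⟨b, hb, hba⟩ := mem_ideal_span_monomial_image.1 (hle ha) a (by simp)
  exact ⟨b, hba, hb⟩

theorem IsMonomialIdeal.degree_of_mem_minGens (hI : IsMonomialIdeal I) {d : ℕ}
    (h : IsGeneratedInDegree I d) {a : Fin n →₀ ℕ} (ha : a ∈ minGens I) : a.degree = d := by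
  obtain ⟨b, hba, hb, hd⟩ := hI.exists_le_of_isGeneratedInDegree h ha.1
  rw [← hd, le_antisymm (ha.2 hb hba) hba]

theorem IsMonomialIdeal.mem_minGens_of_degree_le (hI : IsMonomialIdeal I) {d : ℕ}
    (h : IsGeneratedInDegree I d) {a : Fin n →₀ ℕ} (ha : monomial a (1 : k) ∈ I)
    (had : a.degree ≤ d) : a ∈ minGens I := by
  refine ⟨ha, fun c hc hca => ?_⟩
  obtain ⟨b, hbc, -, hd⟩ := hI.exists_le_of_isGeneratedInDegree h hc
  obtain ⟨e, rfl⟩ := exists_add_of_le (hbc.trans hca)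
  have he : e.degree = 0 := by
    rw [map_add] at had
    omega
  rw [Finsupp.degree_eq_zero_iff] at he
  simpa [he] using hbc

end MonomialIdeals

/-! ### Rank–nullity on a subspace -/

section LinearAlgebra

theorem finrank_map_add_finrank_inf_ker {V W : Type*} [AddCommGroup V] [Module k V]
    [AddCommGroup W] [Module k W] (D : V →ₗ[k] W) (C : Submodule k V) [FiniteDimensional k C] :
    Module.finrank k (C.map D) + Module.finrank k ↥(C ⊓ LinearMap.ker D) =
      Module.finrank k C := by
  rw [← LinearMap.finrank_range_add_finrank_ker (D.domRestrict C), LinearMap.range_domRestrict,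
    LinearMap.ker_domRestrict, ← Submodule.map_comap_subtype, LinearEquiv.finrank_eq
      (Submodule.equivSubtypeMap C ((LinearMap.ker D).comap C.subtype)).symm]

end LinearAlgebra

/-! ### Dimension counts in the Koszul complexes of `J`, `K`, `J ∩ K` and `J + K` -/

section Koszul

variable {I J K : Ideal (MvPolynomial (Fin n) k)} {i j : ℕ}

instance finiteDimensional_koszulChains (I : Ideal (MvPolynomial (Fin n) k)) (i j : ℕ) :
    FiniteDimensional k (koszulChains I i j) := by
  have : FiniteDimensional k (homogeneousSubmodule (Fin n) k (j - i)) :=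
    Module.Finite.iff_fg.2 (homogeneousSubmodule_fg _ _ _)
  have hmem : ∀ (S : Finset (Fin n)) (f : koszulChains I i j),
      f.1 S ∈ homogeneousSubmodule (Fin n) k (j - i) := fun S f => by
    rcases le_or_gt i j with h | h
    · exact (f.2.2 S).2.1 h
    · rw [(f.2.2 S).2.2 h]
      exact Submodule.zero_mem _
  refine Module.Finite.of_injective (LinearMap.pi fun S =>
    ((LinearMap.proj S).comp (koszulChains I i j).subtype).codRestrict
      (homogeneousSubmodule (Fin n) k (j - i)) (hmem S)) fun f g h => ?_
  refine Subtype.ext (_root_.funext fun S => ?_)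
  exact congrArg Subtype.val (congrFun h S)

theorem koszulD_mem_koszulChains {f : Finset (Fin n) → MvPolynomial (Fin n) k}
    (hf : f ∈ koszulChains I (i + 1) j) : koszulD k n f ∈ koszulChains I i j := by
  refine ⟨koszulD_mem hf.1, fun S => ⟨?_, fun h => ?_, fun h => ?_⟩⟩
  · rw [koszulD_apply]
    exact Submodule.sum_mem _ fun v _ => Submodule.smul_of_tower_mem _ _
      (I.mul_mem_left _ (hf.2 _).1)
  · rw [koszulD_apply]
    refine Submodule.sum_mem (homogeneousSubmodule (Fin n) k (j - i)) fun v _ =>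
      Submodule.smul_of_tower_mem _ _ ?_
    rcases h.lt_or_eq with h | rfl
    · have := (isHomogeneous_X k v).mul ((hf.2 (insert v S)).2.1 h)
      rwa [show 1 + (j - (i + 1)) = j - i by omega] at this
    · rw [(hf.2 _).2.2 (Nat.lt_succ_self _), mul_zero]
      exact Submodule.zero_mem _
  · rw [koszulD_apply]
    exact Finset.sum_eq_zero fun v _ => by rw [(hf.2 _).2.2 (by omega), mul_zero, smul_zero]

theorem koszulBoundaries_le_koszulCycles (I : Ideal (MvPolynomial (Fin n) k)) (i j : ℕ) :
    koszulBoundaries I i j ≤ koszulCycles I i j := by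
  rintro _ ⟨f, hf, rfl⟩
  exact ⟨koszulD_mem_koszulChains hf, koszulD_koszulD f⟩

theorem koszulCycles_zero (I : Ideal (MvPolynomial (Fin n) k)) (j : ℕ) :
    koszulCycles I 0 j = koszulChains I 0 j := by
  refine inf_eq_left.2 fun f hf => ?_
  change koszulD k n f = 0
  funext T
  rw [koszulD_apply]
  refine Finset.sum_eq_zero fun v _ => ?_
  rw [hf.1 (insert v T) (Finset.card_ne_zero_of_mem (Finset.mem_insert_self v T)), mul_zero,
    smul_zero]

theorem koszulChains_mono (h : J ≤ I) : koszulChains J i j ≤ koszulChains I i j :=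
  fun _ hf => ⟨hf.1, fun S => ⟨h (hf.2 S).1, (hf.2 S).2⟩⟩

theorem koszulCycles_mono (h : J ≤ I) : koszulCycles J i j ≤ koszulCycles I i j :=
  inf_le_inf_right _ (koszulChains_mono h)

theorem koszulChains_inf : koszulChains (J ⊓ K) i j = koszulChains J i j ⊓ koszulChains K i j :=
  le_antisymm (le_inf (koszulChains_mono inf_le_left) (koszulChains_mono inf_le_right))
    fun _ hf => ⟨hf.1.1, fun S => ⟨⟨(hf.1.2 S).1, (hf.2.2 S).1⟩, (hf.1.2 S).2⟩⟩

/-- A homogeneous element of `J + K` is a sum of homogeneous elements of `J` and `K`, because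
monomial ideals are closed under taking homogeneous components. -/
theorem koszulChains_sup (hJ : IsMonomialIdeal J) (hK : IsMonomialIdeal K) :
    koszulChains (J ⊔ K) i j = koszulChains J i j ⊔ koszulChains K i j := by
  classical
  refine le_antisymm (fun f hf => ?_)
    (sup_le (koszulChains_mono le_sup_left) (koszulChains_mono le_sup_right))
  have hsplit : ∀ S, ∃ p ∈ J, ∃ q ∈ K, p + q = f S := fun S => Submodule.mem_sup.1 (hf.2 S).1
  choose p hp q hq hpq using hsplit
  have hmem : ∀ {L : Ideal (MvPolynomial (Fin n) k)}, IsMonomialIdeal L →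
      ∀ {r : Finset (Fin n) → MvPolynomial (Fin n) k}, (∀ S, r S ∈ L) →
      (fun S => if S.card = i ∧ i ≤ j then homogeneousComponent (j - i) (r S) else 0) ∈
        koszulChains L i j := by
    intro L hL r hr
    refine ⟨fun S hS => if_neg fun h => hS h.1, fun S => ?_⟩
    dsimp only
    split_ifs with h
    · exact ⟨hL.homogeneousComponent_mem (hr S) _, fun _ => homogeneousComponent_isHomogeneous _ _,
        fun hlt => absurd h.2 (not_le.2 hlt)⟩
    · exact ⟨L.zero_mem, fun _ => isHomogeneous_zero _ _ _, fun _ => rfl⟩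
  refine Submodule.mem_sup.2 ⟨_, hmem hJ hp, _, hmem hK hq, _root_.funext fun S => ?_⟩
  rw [Pi.add_apply]
  split_ifs with h
  · rw [← map_add, hpq, homogeneousComponent_of_mem ((hf.2 S).2.1 h.2), if_pos rfl]
  · rw [add_zero]
    rcases not_and_or.1 h with h | h
    · exact (hf.1 S h).symm
    · exact ((hf.2 S).2.2 (not_le.1 h)).symm

instance finiteDimensional_koszulCycles (I : Ideal (MvPolynomial (Fin n) k)) (i j : ℕ) :
    FiniteDimensional k (koszulCycles I i j) :=
  Submodule.finiteDimensional_of_le (inf_le_left : koszulCycles I i j ≤ koszulChains I i j)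

instance finiteDimensional_koszulBoundaries (I : Ideal (MvPolynomial (Fin n) k)) (i j : ℕ) :
    FiniteDimensional k (koszulBoundaries I i j) :=
  Submodule.finiteDimensional_of_le (koszulBoundaries_le_koszulCycles I i j)

theorem gradedBetti_add_finrank_koszulBoundaries (I : Ideal (MvPolynomial (Fin n) k)) (i j : ℕ) :
    gradedBetti I i j + Module.finrank k (koszulBoundaries I i j) =
      Module.finrank k (koszulCycles I i j) := by
  rw [← Submodule.finrank_quotient_add_finrank
    ((koszulBoundaries I i j).submoduleOf (koszulCycles I i j)), LinearEquiv.finrank_eq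
      (Submodule.submoduleOfEquivOfLe (koszulBoundaries_le_koszulCycles I i j)), gradedBetti]

theorem gradedBetti_eq_zero_iff :
    gradedBetti I i j = 0 ↔ koszulCycles I i j ≤ koszulBoundaries I i j := by
  have h := gradedBetti_add_finrank_koszulBoundaries I i j
  constructor
  · intro h0
    rw [h0, zero_add] at h
    exact (Submodule.eq_of_le_of_finrank_eq (koszulBoundaries_le_koszulCycles I i j) h).ge
  · intro hle
    have := Submodule.finrank_mono hle
    omega

theorem gradedBetti_eq_zero_of_lt (I : Ideal (MvPolynomial (Fin n) k)) (h : j < i) :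
    gradedBetti I i j = 0 := by
  refine gradedBetti_eq_zero_iff.2 fun f hf => ?_
  rw [show f = 0 from _root_.funext fun S => (hf.1.2 S).2.2 h]
  exact Submodule.zero_mem _

theorem koszulCycles_inf : koszulCycles (J ⊓ K) i j = koszulCycles J i j ⊓ koszulCycles K i j := by
  rw [koszulCycles, koszulChains_inf, inf_inf_distrib_right]
  rfl

theorem koszulBoundaries_sup (hJ : IsMonomialIdeal J) (hK : IsMonomialIdeal K) :
    koszulBoundaries (J ⊔ K) i j = koszulBoundaries J i j ⊔ koszulBoundaries K i j := by
  rw [koszulBoundaries, koszulChains_sup hJ hK, Submodule.map_sup]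
  rfl

theorem finrank_koszulBoundaries_add_finrank_koszulCycles (I : Ideal (MvPolynomial (Fin n) k))
    (i j : ℕ) : Module.finrank k (koszulBoundaries I i j) +
      Module.finrank k (koszulCycles I (i + 1) j) = Module.finrank k (koszulChains I (i + 1) j) :=
  finrank_map_add_finrank_inf_ker ((koszulD k n).restrictScalars k) (koszulChains I (i + 1) j)

theorem finrank_koszulChains_sup (hJ : IsMonomialIdeal J) (hK : IsMonomialIdeal K) (i j : ℕ) :
    Module.finrank k (koszulChains (J ⊔ K) i j) + Module.finrank k (koszulChains (J ⊓ K) i j) =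
      Module.finrank k (koszulChains J i j) + Module.finrank k (koszulChains K i j) := by
  rw [koszulChains_sup hJ hK, koszulChains_inf, Submodule.finrank_sup_add_finrank_inf_eq]

/-- If every cycle of `J ∩ K` bounds both in `J` and in `K`, the boundaries common to `J` and `K`
are exactly the cycles of `J ∩ K`. -/
theorem finrank_koszulBoundaries_sup (hJ : IsMonomialIdeal J) (hK : IsMonomialIdeal K)
    (h : koszulCycles (J ⊓ K) i j ≤ koszulBoundaries J i j ⊓ koszulBoundaries K i j) :
    Module.finrank k (koszulBoundaries (J ⊔ K) i j) +
        Module.finrank k (koszulCycles (J ⊓ K) i j) =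
      Module.finrank k (koszulBoundaries J i j) + Module.finrank k (koszulBoundaries K i j) := by
  have hinf : koszulCycles (J ⊓ K) i j = koszulBoundaries J i j ⊓ koszulBoundaries K i j :=
    h.antisymm (koszulCycles_inf (J := J) (K := K) ▸ inf_le_inf
      (koszulBoundaries_le_koszulCycles J i j) (koszulBoundaries_le_koszulCycles K i j))
  rw [koszulBoundaries_sup hJ hK, hinf, Submodule.finrank_sup_add_finrank_inf_eq]

theorem gradedBetti_sup_zero (hJ : IsMonomialIdeal J) (hK : IsMonomialIdeal K)
    (h : koszulCycles (J ⊓ K) 0 j ≤ koszulBoundaries J 0 j ⊓ koszulBoundaries K 0 j) :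
    gradedBetti (J ⊔ K) 0 j = gradedBetti J 0 j + gradedBetti K 0 j := by
  have hb := finrank_koszulBoundaries_sup hJ hK h
  have hc := finrank_koszulChains_sup hJ hK 0 j
  rw [← koszulCycles_zero, ← koszulCycles_zero, ← koszulCycles_zero, ← koszulCycles_zero] at hc
  have h1 := gradedBetti_add_finrank_koszulBoundaries (J ⊔ K) 0 j
  have h2 := gradedBetti_add_finrank_koszulBoundaries J 0 j
  have h3 := gradedBetti_add_finrank_koszulBoundaries K 0 j
  omega

/-- The additivity of Betti numbers when the maps
`Tor(J ∩ K, k)_j → Tor(J, k)_j ⊕ Tor(K, k)_j` vanish in homological degrees `i` and `i + 1`.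
All four Betti numbers are written through dimensions of chains, cycles and boundaries. -/
theorem gradedBetti_sup_succ (hJ : IsMonomialIdeal J) (hK : IsMonomialIdeal K)
    (h : koszulCycles (J ⊓ K) i j ≤ koszulBoundaries J i j ⊓ koszulBoundaries K i j)
    (h' : koszulCycles (J ⊓ K) (i + 1) j ≤
      koszulBoundaries J (i + 1) j ⊓ koszulBoundaries K (i + 1) j) :
    gradedBetti (J ⊔ K) (i + 1) j =
      gradedBetti J (i + 1) j + gradedBetti K (i + 1) j + gradedBetti (J ⊓ K) i j := by
  have hb := finrank_koszulBoundaries_sup hJ hK h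
  have hb' := finrank_koszulBoundaries_sup hJ hK h'
  have hc := finrank_koszulChains_sup hJ hK (i + 1) j
  have r1 := finrank_koszulBoundaries_add_finrank_koszulCycles (J ⊔ K) i j
  have r2 := finrank_koszulBoundaries_add_finrank_koszulCycles J i j
  have r3 := finrank_koszulBoundaries_add_finrank_koszulCycles K i j
  have r4 := finrank_koszulBoundaries_add_finrank_koszulCycles (J ⊓ K) i j
  have h1 := gradedBetti_add_finrank_koszulBoundaries (J ⊔ K) (i + 1) j
  have h2 := gradedBetti_add_finrank_koszulBoundaries J (i + 1) j
  have h3 := gradedBetti_add_finrank_koszulBoundaries K (i + 1) j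
  have h4 := gradedBetti_add_finrank_koszulBoundaries (J ⊓ K) i j
  omega

/-- A minimal generator `x ^ a` is not in `(x_1, …, x_n) I`, so it gives a nonzero class in
`Tor_0(I, k) = I ⧸ (x_1, …, x_n) I`. -/
theorem IsMonomialIdeal.gradedBetti_zero_ne_zero (hI : IsMonomialIdeal I) {a : Fin n →₀ ℕ}
    (ha : a ∈ minGens I) : gradedBetti I 0 a.degree ≠ 0 := by
  classical
  intro h0
  have hcyc : (Pi.single ∅ (monomial a (1 : k)) : Finset (Fin n) → MvPolynomial (Fin n) k) ∈
      koszulCycles I 0 a.degree := by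
    rw [koszulCycles_zero]
    refine ⟨fun S hS => Pi.single_eq_of_ne (by simpa using hS) _, fun S => ?_⟩
    by_cases hS : S = ∅
    · subst hS
      rw [Pi.single_eq_same]
      exact ⟨ha.1, fun _ => isHomogeneous_monomial _ rfl, fun h => absurd h (Nat.not_lt_zero _)⟩
    · rw [Pi.single_eq_of_ne hS]
      exact ⟨I.zero_mem, fun _ => isHomogeneous_zero _ _ _, fun _ => rfl⟩
  obtain ⟨g, hg, hga⟩ := gradedBetti_eq_zero_iff.1 h0 hcyc
  have hcoeff := congrArg (coeff a) (congrFun hga ∅)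
  rw [LinearMap.restrictScalars_apply, koszulD_apply, Pi.single_eq_same, coeff_monomial,
    if_pos rfl, coeff_sum] at hcoeff
  obtain ⟨v, -, hv⟩ := Finset.exists_ne_zero_of_sum_ne_zero (hcoeff.symm ▸ one_ne_zero)
  rw [coeff_smul, coeff_X_mul'] at hv
  split_ifs at hv with hva
  · have hmem : monomial (a - Finsupp.single v 1) (1 : k) ∈ I :=
      hI.mem_iff.1 (hg.2 _).1 _ (mem_support_iff.2 fun h => hv (by rw [h, smul_zero]))
    -- `x ^ a / x_v` is in `I`, against the minimality of `a`.
    have hle := ha.2 hmem tsub_le_self v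
    have := Finsupp.mem_support_iff.1 hva
    simp only [Finsupp.coe_tsub, Pi.sub_apply, Finsupp.single_eq_same] at hle
    omega
  · exact hv (smul_zero _)

end Koszul

/-! ### Linear resolutions and Betti splittings -/

section Linear

variable {I J K : Ideal (MvPolynomial (Fin n) k)} {d : ℕ}

/-- A monomial of degree `d` in `J ∩ K` would be a common minimal generator. -/
theorem lt_degree_of_monomial_mem_inf (hJ : IsMonomialIdeal J) (hK : IsMonomialIdeal K)
    (hJd : IsGeneratedInDegree J d) (hKd : IsGeneratedInDegree K d)
    (hdisj : minGens J ∩ minGens K = ∅) {a : Fin n →₀ ℕ} (ha : monomial a (1 : k) ∈ J ⊓ K) :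
    d < a.degree := by
  by_contra! h
  exact hdisj.subset ⟨hJ.mem_minGens_of_degree_le hJd ha.1 h,
    hK.mem_minGens_of_degree_le hKd ha.2 h⟩

/-- The maps `Tor_i(J ∩ K, k)_j → Tor_i(J, k)_j ⊕ Tor_i(K, k)_j` all vanish: the target is zero for
`j ≠ i + d`, and the chains of the source are zero for `j = i + d`. -/
theorem koszulCycles_inf_le_koszulBoundaries (hJ : IsMonomialIdeal J) (hK : IsMonomialIdeal K)
    (hJd : HasLinearResolution J d) (hKd : HasLinearResolution K d)
    (hdisj : minGens J ∩ minGens K = ∅) (i j : ℕ) :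
    koszulCycles (J ⊓ K) i j ≤ koszulBoundaries J i j ⊓ koszulBoundaries K i j := by
  rcases lt_or_ge j i with hij | hij
  · exact le_inf
      ((koszulCycles_mono inf_le_left).trans
        (gradedBetti_eq_zero_iff.1 (gradedBetti_eq_zero_of_lt J hij)))
      ((koszulCycles_mono inf_le_right).trans
        (gradedBetti_eq_zero_iff.1 (gradedBetti_eq_zero_of_lt K hij)))
  obtain ⟨e, rfl⟩ := Nat.exists_eq_add_of_le hij
  by_cases he : e = d
  · subst he
    -- The chains of `J ∩ K` have coefficients of degree `e` in this strand, so they vanish.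
    intro f hf
    rw [show f = 0 from _root_.funext fun S => ?_]
    · exact Submodule.zero_mem _
    · by_contra hne
      obtain ⟨a, ha⟩ := support_nonempty.2 hne
      have hlt := lt_degree_of_monomial_mem_inf hJ hK hJd.1 hKd.1 hdisj
        ((hJ.inf hK).mem_iff.1 (hf.1.2 S).1 a ha)
      refine mem_support_iff.1 ha (((hf.1.2 S).2.1 hij).coeff_eq_zero ?_)
      omega
  · exact le_inf
      ((koszulCycles_mono inf_le_left).trans (gradedBetti_eq_zero_iff.1 (hJd.2 i e he)))
      ((koszulCycles_mono inf_le_right).trans (gradedBetti_eq_zero_iff.1 (hKd.2 i e he)))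

theorem IsBettiSplitting.gradedBetti_add_le (h : IsBettiSplitting I J K) (i j : ℕ) :
    gradedBetti J i j + gradedBetti K i j ≤ gradedBetti I i j := by
  cases i with
  | zero => exact (h.betti_zero j).ge
  | succ i => exact (Nat.le_add_right _ _).trans (h.betti_succ i j).ge

theorem IsBettiSplitting.gradedBetti_inf_eq_zero (h : IsBettiSplitting I J K)
    (hlin : HasLinearResolution I d) (i j : ℕ) (hj : j ≠ d + 1) :
    gradedBetti (J ⊓ K) i (i + j) = 0 := by
  have hs := h.betti_succ i (i + j)
  have h0 : gradedBetti I (i + 1) (i + j) = 0 := by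
    cases j with
    | zero => exact gradedBetti_eq_zero_of_lt I (Nat.lt_succ_self i)
    | succ j =>
      rw [← add_assoc, add_right_comm]
      exact hlin.2 (i + 1) j fun hjd => hj (by rw [hjd])
  omega

end Linear

end BettiSplitting

theorem mainTheorem2 {k : Type*} [Field k] (n d : ℕ) (hd : 0 < d)
    (I J K : Ideal (MvPolynomial (Fin n) k))
    (hI : BettiSplitting.IsMonomialIdeal I) (hJ : BettiSplitting.IsMonomialIdeal J)
    (hK : BettiSplitting.IsMonomialIdeal K) (hJ0 : J ≠ ⊥) (hK0 : K ≠ ⊥)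
    (hlin : BettiSplitting.HasLinearResolution I d) (hadd : I = J + K)
    (hG : BettiSplitting.minGens I = BettiSplitting.minGens J ∪ BettiSplitting.minGens K)
    (hdisj : BettiSplitting.minGens J ∩ BettiSplitting.minGens K = ∅) :
    (BettiSplitting.IsBettiSplitting I J K ↔
      BettiSplitting.HasLinearResolution J d ∧ BettiSplitting.HasLinearResolution K d) ∧
    (BettiSplitting.IsBettiSplitting I J K →
      BettiSplitting.HasLinearResolution (J ⊓ K) (d + 1)) := by
  refine ⟨⟨fun h => ?_, fun h => ?_⟩, fun h => ⟨?_, h.gradedBetti_inf_eq_zero hlin⟩⟩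
  · refine ⟨⟨hJ.isGeneratedInDegree fun a ha => ?_, fun i j hj => ?_⟩,
      hK.isGeneratedInDegree fun a ha => ?_, fun i j hj => ?_⟩
    · exact hI.degree_of_mem_minGens hlin.1 (hG ▸ Or.inl ha)
    · have := h.gradedBetti_add_le i (i + j)
      have := hlin.2 i j hj
      omega
    · exact hI.degree_of_mem_minGens hlin.1 (hG ▸ Or.inr ha)
    · have := h.gradedBetti_add_le i (i + j)
      have := hlin.2 i j hj
      omega
  · have hle := BettiSplitting.koszulCycles_inf_le_koszulBoundaries hJ hK h.1 h.2 hdisj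
    refine ⟨hadd, hG, Set.disjoint_iff_inter_eq_empty.2 hdisj, fun j => ?_, fun i j => ?_⟩
    · rw [hadd, Submodule.add_eq_sup]
      exact BettiSplitting.gradedBetti_sup_zero hJ hK (hle 0 j)
    · rw [hadd, Submodule.add_eq_sup]
      exact BettiSplitting.gradedBetti_sup_succ hJ hK (hle i j) (hle (i + 1) j)
  · refine (hJ.inf hK).isGeneratedInDegree fun a ha => ?_
    by_contra hne
    have h0 := h.gradedBetti_inf_eq_zero hlin 0 a.degree hne
    rw [zero_add] at h0
    exact (hJ.inf hK).gradedBetti_zero_ne_zero ha h0
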